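/- Let $(W,S)$ be a Coxeter system of finite rank, and write $\langle R\rangle$ for the subgroup of $W$ generated by $R\subseteq S$; such subgroups are called visual. A subset $C\subseteq S$ is complete if the product of any two elements of $C$ has finite order. For $R\subseteq S$, a separation of $R$ is a triple $(S_1,S_0,S_2)$ with $R=S_1\cup S_2$, $S_0=S_1\cap S_2$, $S_1\setminus S_0\neq\emptyset$, $S_2\setminus S_0\neq\emptyset$, such that $ab$ has infinite order for all $a\in S_1\setminus S_0$ and $b\in S_2\setminus S_0$; then $S_0$ is said to separate $R$. For $a,b\in S$, a set $S_0$ is an $(a,b)$-separator of $S$ if there is a separation $(S_1,S_0,S_2)$ of $S$ with $a\in S_1\setminus S_0$ and $b\in S_2\setminus S_0$; it is a minimal $(a,b)$-separator if moreover no other subset of $S_0$ is an $(a,b)$-separator of $S$. A relative minimal separator of $S$ is a set that is a minimal $(a,b)$-separator of $S$ for some $a,b\in S$. Let $\Psi$ be a reduced graph of groups decomposition of $W$ (reduced: for each edge that is not a loop, the edge group is a proper subgroup of the vertex groups at both ends) all of whose vertex groups and edge groups are visual. Suppose that whenever $\langle R\rangle$, $R\subseteq S$, is a vertex group of $\Psi$,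 the set $R$ is not separated by a complete subset, and that each edge group of $\Psi$ is generated by a complete subset of $S$. Theorem 2.5. Let $\mathcal V$ be the set of all maximal subsets of $S$ that are not separated by a complete subset, and let $\mathcal E$ be the set of all complete relative minimal separators of $S$. Then the vertex groups of $\Psi$ are exactly the subgroups $\langle R\rangle$ with $R\in\mathcal V$, and the edge groups of $\Psi$ are exactly the subgroups $\langle T\rangle$ with $T\in\mathcal E$. -/

import Mathlib

universe u v w x y

/-- A graph of groups. The underlying graph is a multigraph (loops and multiple edges are allowed)
with vertex set `V` and edge set `E`, each edge being given an arbitrary orientation; every vertex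
and every edge carries a group, and each edge group is embedded in the groups of its two ends. -/
structure GraphOfGroups where
  V : Type u
  E : Type v
  src : E → V
  tgt : E → V
  vGroup : V → Type w
  eGroup : E → Type x
  [vInst : ∀ p, Group (vGroup p)]
  [eInst : ∀ e, Group (eGroup e)]
  toSrc : ∀ e, eGroup e →* vGroup (src e)
  toTgt : ∀ e, eGroup e →* vGroup (tgt e)
  toSrc_injective : ∀ e, Function.Injective (toSrc e)
  toTgt_injective : ∀ e, Function.Injective (toTgt e)

namespace GraphOfGroups

attribute [instance] GraphOfGroups.vInst GraphOfGroups.eInst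

/-- A set `T` of edges is a maximal (= spanning) tree of the underlying graph: it has no loops and
no two parallel edges, and the simple graph on all the vertices with the edges in `T` is a tree.
In particular a graph having a maximal tree is nonempty and connected. -/
structure IsMaximalTree (G : GraphOfGroups.{u, v, w, x}) (T : Set G.E) : Prop where
  no_loop : ∀ e ∈ T, G.src e ≠ G.tgt e
  no_parallel : Set.InjOn (fun e => s(G.src e, G.tgt e)) T
  isTree : (SimpleGraph.fromEdgeSet ((fun e => s(G.src e, G.tgt e)) '' T)).IsTree

/-- The free product of all the vertex groups and of the free group on the edges. -/
abbrev FreeProd (G : GraphOfGroups.{u, v, w, x}) : Type (max u v w) :=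
  Monoid.Coprod (Monoid.CoprodI G.vGroup) (FreeGroup G.E)

/-- An element of a vertex group, as an element of the free product. -/
def ofVertex (G : GraphOfGroups.{u, v, w, x}) (p : G.V) : G.vGroup p →* G.FreeProd :=
  Monoid.Coprod.inl.comp Monoid.CoprodI.of

/-- The stable letter of an edge, as an element of the free product. -/
def letter (G : GraphOfGroups.{u, v, w, x}) (e : G.E) : G.FreeProd :=
  Monoid.Coprod.inr (FreeGroup.of e)

/-- The relators of the fundamental group with respect to `T`: `t_e⁻¹ g t_e = g'`, where `g`, `g'`
are the images of an element of the group of the edge `e` in the groups of the source and of the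
target of `e`, and `t_e = 1` when `e` belongs to `T`. -/
def relators (G : GraphOfGroups.{u, v, w, x}) (T : Set G.E) : Set G.FreeProd :=
  {r | ∃ (e : G.E) (g : G.eGroup e),
      r = (G.letter e)⁻¹ * G.ofVertex (G.src e) (G.toSrc e g) * G.letter e *
        (G.ofVertex (G.tgt e) (G.toTgt e g))⁻¹} ∪
    {r | ∃ e ∈ T, r = G.letter e}

/-- The fundamental group of a graph of groups with respect to a maximal tree `T`. -/
abbrev FundamentalGroup (G : GraphOfGroups.{u, v, w, x}) (T : Set G.E) : Type (max u v w) :=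
  G.FreeProd ⧸ Subgroup.normalClosure (G.relators T)

end GraphOfGroups

/-- A graph of groups decomposition of a group `W`: a graph of groups with a maximal tree of its
graph, and an isomorphism of its fundamental group with `W`. -/
structure GraphOfGroupsDecomposition (W : Type y) [Group W] where
  gog : GraphOfGroups.{u, v, w, x}
  tree : Set gog.E
  isMaximalTree : gog.IsMaximalTree tree
  iso : gog.FundamentalGroup tree ≃* W

namespace GraphOfGroupsDecomposition

/-- The homomorphism from the group at a vertex to `W`. -/
def vertexHom {W : Type y} [Group W] (Ψ : GraphOfGroupsDecomposition.{u, v, w, x, y} W)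
    (p : Ψ.gog.V) : Ψ.gog.vGroup p →* W :=
  (Ψ.iso.toMonoidHom.comp (QuotientGroup.mk' _)).comp (Ψ.gog.ofVertex p)

/-- The vertex group at `p`, as a subgroup of `W`. -/
def vertexSubgroup {W : Type y} [Group W] (Ψ : GraphOfGroupsDecomposition.{u, v, w, x, y} W)
    (p : Ψ.gog.V) : Subgroup W :=
  (Ψ.vertexHom p).range

/-- The edge group at `e`, as a subgroup of `W`. It is embedded through the source of `e`; for an
edge of the maximal tree, embedding it through the target gives the same subgroup
(`edgeSubgroup_eq_of_mem_tree`), and for other edges a conjugate one. -/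
def edgeSubgroup {W : Type y} [Group W] (Ψ : GraphOfGroupsDecomposition.{u, v, w, x, y} W)
    (e : Ψ.gog.E) : Subgroup W :=
  ((Ψ.vertexHom (Ψ.gog.src e)).comp (Ψ.gog.toSrc e)).range

theorem vertexHom_toSrc_eq_of_mem_tree {W : Type y} [Group W]
    (Ψ : GraphOfGroupsDecomposition.{u, v, w, x, y} W) (e : Ψ.gog.E) (he : e ∈ Ψ.tree)
    (g : Ψ.gog.eGroup e) :
    Ψ.vertexHom (Ψ.gog.src e) (Ψ.gog.toSrc e g) = Ψ.vertexHom (Ψ.gog.tgt e) (Ψ.gog.toTgt e g) := by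
  have h1 : (QuotientGroup.mk' (Subgroup.normalClosure (Ψ.gog.relators Ψ.tree)))
      (Ψ.gog.letter e) = 1 :=
    (QuotientGroup.eq_one_iff _).2 (Subgroup.subset_normalClosure (Or.inr ⟨e, he, rfl⟩))
  have h2 : (QuotientGroup.mk' (Subgroup.normalClosure (Ψ.gog.relators Ψ.tree)))
      ((Ψ.gog.letter e)⁻¹ * Ψ.gog.ofVertex (Ψ.gog.src e) (Ψ.gog.toSrc e g) * Ψ.gog.letter e *
        (Ψ.gog.ofVertex (Ψ.gog.tgt e) (Ψ.gog.toTgt e g))⁻¹) = 1 :=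
    (QuotientGroup.eq_one_iff _).2 (Subgroup.subset_normalClosure (Or.inl ⟨e, g, rfl⟩))
  simp only [map_mul, map_inv, h1, inv_one, one_mul, mul_one] at h2
  exact congrArg Ψ.iso (mul_inv_eq_one.1 h2)

theorem edgeSubgroup_eq_of_mem_tree {W : Type y} [Group W]
    (Ψ : GraphOfGroupsDecomposition.{u, v, w, x, y} W) (e : Ψ.gog.E) (he : e ∈ Ψ.tree) :
    Ψ.edgeSubgroup e = ((Ψ.vertexHom (Ψ.gog.tgt e)).comp (Ψ.gog.toTgt e)).range := by
  have h : (Ψ.vertexHom (Ψ.gog.src e)).comp (Ψ.gog.toSrc e) =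
      (Ψ.vertexHom (Ψ.gog.tgt e)).comp (Ψ.gog.toTgt e) :=
    MonoidHom.ext (Ψ.vertexHom_toSrc_eq_of_mem_tree e he)
  unfold edgeSubgroup
  rw [h]

/-- The decomposition is reduced: for every edge which is not a loop, the edge group is a proper
subgroup of the vertex groups at both ends. -/
def IsReduced {W : Type y} [Group W] (Ψ : GraphOfGroupsDecomposition.{u, v, w, x, y} W) : Prop :=
  ∀ e, Ψ.gog.src e ≠ Ψ.gog.tgt e →
    ¬ Function.Surjective (Ψ.gog.toSrc e) ∧ ¬ Function.Surjective (Ψ.gog.toTgt e)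

/-- All the vertex groups and all the edge groups are visual, i.e. generated by subsets of `S`. -/
def IsVisual {W : Type y} [Group W] (Ψ : GraphOfGroupsDecomposition.{u, v, w, x, y} W)
    (S : Set W) : Prop :=
  (∀ p, ∃ R ⊆ S, Ψ.vertexSubgroup p = Subgroup.closure R) ∧
    (∀ e, ∃ T ⊆ S, Ψ.edgeSubgroup e = Subgroup.closure T)

/-- `(V, R)` is a vertex system: `V` is a vertex group, generated by the subset `R` of `S`. -/
def IsVertexSystem {W : Type y} [Group W] (Ψ : GraphOfGroupsDecomposition.{u, v, w, x, y} W)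
    (S : Set W) (V : Subgroup W) (R : Set W) : Prop :=
  V ∈ Set.range Ψ.vertexSubgroup ∧ R ⊆ S ∧ V = Subgroup.closure R

end GraphOfGroupsDecomposition

namespace CoxeterSeparation

/-- A set of generators is complete if the product of any two of its elements has finite order. -/
def IsComplete {W : Type y} [Group W] (C : Set W) : Prop :=
  ∀ s ∈ C, ∀ t ∈ C, IsOfFinOrder (s * t)

/-- `(S₁, S₀, S₂)` is a separation of the set `R`; `m(a, b) = ∞` means that `a * b` has infinite
order. -/
structure IsSeparation {W : Type y} [Group W] (R S₁ S₀ S₂ : Set W) : Prop where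
  union_eq : R = S₁ ∪ S₂
  inter_eq : S₀ = S₁ ∩ S₂
  infinite_order : ∀ a ∈ S₁ \ S₀, ∀ b ∈ S₂ \ S₀, ¬ IsOfFinOrder (a * b)
  left_nonempty : (S₁ \ S₀).Nonempty
  right_nonempty : (S₂ \ S₀).Nonempty

/-- `S₀` separates `R`. -/
def Separates {W : Type y} [Group W] (S₀ R : Set W) : Prop :=
  ∃ S₁ S₂, IsSeparation R S₁ S₀ S₂

/-- `R` is separated by a complete subset. -/
def SeparatedByComplete {W : Type y} [Group W] (R : Set W) : Prop :=
  ∃ C, IsComplete C ∧ Separates C R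

/-- `S₀` is an `(a, b)`-separator of `S`. -/
def IsABSeparator {W : Type y} [Group W] (S : Set W) (a b : W) (S₀ : Set W) : Prop :=
  ∃ S₁ S₂, IsSeparation S S₁ S₀ S₂ ∧ a ∈ S₁ \ S₀ ∧ b ∈ S₂ \ S₀

/-- `S₀` is a minimal `(a, b)`-separator of `S`. -/
def IsMinimalABSeparator {W : Type y} [Group W] (S : Set W) (a b : W) (S₀ : Set W) : Prop :=
  IsABSeparator S a b S₀ ∧ ∀ S₀' ⊆ S₀, IsABSeparator S a b S₀' → S₀' = S₀

/-- `S₀` is a relative minimal separator of `S`. -/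
def IsRelativeMinimalSeparator {W : Type y} [Group W] (S S₀ : Set W) : Prop :=
  ∃ a ∈ S, ∃ b ∈ S, IsMinimalABSeparator S a b S₀

/-- The set of all maximal subsets of `S` that are not separated by a complete subset. -/
def maximalUnseparated {W : Type y} [Group W] (S : Set W) : Set (Set W) :=
  {R | Maximal (fun R' => R' ⊆ S ∧ ¬ SeparatedByComplete R') R}

/-- The set of all complete, relative minimal separators of `S`. -/
def completeRelativeMinimalSeparators {W : Type y} [Group W] (S : Set W) : Set (Set W) :=
  {T | IsComplete T ∧ IsRelativeMinimalSeparator S T}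

end CoxeterSeparation

/-! The simple reflections are involutions, so `W` has no nontrivial homomorphism to `ℤ` and the
graph of `Ψ` is a tree. Choose generating sets `R p`, `T e` in `S` for the vertex and edge groups.
Cutting the tree at `e` maps `W` to an amalgam of the two sides over the edge group. Normal forms
then show that an element of both sides lies in the edge group, and that elements of different sides
outside the edge group have a product of infinite order. In the geometric representation a simple
reflection lies in a visual subgroup only if it is one of its generators, so these facts become
statements about the sets `R p` and `T e`. They are recorded in `IsCompleteTree`.

The rest is combinatorics of a tree of bags. An unseparated set cannot straddle a complete
separator, hence lies in one bag. Bags are incomparable because each `T e` is proper in its end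
bags, so they are the maximal unseparated sets. A complete separator of `a` and `b` has every bag on
one side, so it contains some `T e` that also separates `a` and `b`; minimality makes them equal.
Conversely, any separator of suitable `a`, `b` inside `T e` contains the intersection of the two end
bags, hence `T e`.

Reducedness concerns the abstract groups. To use it inside `W`, vertex groups must embed
(`vertexHom_injective`); this is shown by an action on a large set. -/

namespace Module

/-! ### Products of two reflections -/

open Polynomial.Chebyshev Real

/-- Two reflections whose product is a rotation of angle `2π / m` satisfy the braid relation of
length `m`. -/
theorem reflection_mul_reflection_pow_eq_one {V : Type*} [AddCommGroup V] [Module ℝ V]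
    {x y : V} {f g : Dual ℝ V} (hf : f x = 2) (hg : g y = 2) {m : ℕ} (hm : 2 ≤ m)
    (hfg : f y = -2 * cos (π / m)) (hgf : g x = -2 * cos (π / m)) :
    (reflection hf * reflection hg) ^ m = 1 := by
  -- For `m = 2` the angle `θ` below is `π`, and one cannot divide by `sin θ`.
  obtain rfl | hm : m = 2 ∨ 2 < m := by omega
  · have h0 : cos (π / (2 : ℕ)) = 0 := by simp
    rw [h0, mul_zero] at hfg hgf
    ext z
    simp only [pow_two, LinearEquiv.mul_apply, reflection_apply, map_sub, map_smul, hfg, hgf, hf, hg,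
      LinearEquiv.coe_one, id_eq]
    module
  · set θ : ℝ := 2 * π / m with hθ
    have hm0 : (0 : ℝ) < m := by positivity
    have hm2 : (2 : ℝ) < m := by exact_mod_cast hm
    have hmθ : m * θ = 2 * π := by rw [hθ]; field_simp
    have hsin : sin θ ≠ 0 := by
      refine (sin_pos_of_pos_of_lt_pi (by positivity) ?_).ne'
      rw [hθ, div_lt_iff₀ hm0]
      nlinarith [pi_pos]
    have ht : 2 * cos θ = f y * g x - 2 := by
      rw [hfg, hgf, hθ, mul_div_assoc, cos_two_mul]; ring
    have hS (n : ℤ) : (S ℝ n).eval (2 * cos θ) = sin ((n + 1) * θ) / sin θ := by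
      rw [eq_div_iff hsin, S_two_mul_real_cos]
    -- These are the coefficients in `reflection_mul_reflection_pow_apply`. They vanish since `sin
    -- (kθ) = 0` when `m = 2k`, and `sin ((k+1)θ) = -sin (kθ)` when `m = 2k + 1`.
    have h1 : (S ℝ (((m : ℤ) - 2) / 2)).eval (2 * cos θ) *
        ((S ℝ (((m : ℤ) - 1) / 2)).eval (2 * cos θ) +
          (S ℝ (((m : ℤ) - 3) / 2)).eval (2 * cos θ)) = 0 ∧
        (S ℝ (((m : ℤ) - 1) / 2)).eval (2 * cos θ) *
        ((S ℝ ((m : ℤ) / 2)).eval (2 * cos θ) +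
          (S ℝ (((m : ℤ) - 2) / 2)).eval (2 * cos θ)) = 0 := by
      obtain ⟨k, hk | hk⟩ := Nat.even_or_odd' m
      · have e1 : ((m : ℤ) - 2) / 2 = k - 1 := by omega
        have e2 : ((m : ℤ) - 1) / 2 = k - 1 := by omega
        have hkθ : (k : ℝ) * θ = π := by
          have : (m : ℝ) = 2 * k := by exact_mod_cast hk
          rw [this] at hmθ; linarith
        have : (S ℝ ((k : ℤ) - 1)).eval (2 * cos θ) = 0 := by
          rw [hS]; push_cast; rw [sub_add_cancel, hkθ, sin_pi, zero_div]
        rw [e1, e2, this, zero_mul, zero_mul]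
        exact ⟨rfl, rfl⟩
      · have e1 : ((m : ℤ) - 2) / 2 = k - 1 := by omega
        have e2 : ((m : ℤ) - 1) / 2 = k := by omega
        have e3 : ((m : ℤ) - 3) / 2 = k - 1 := by omega
        have e4 : (m : ℤ) / 2 = k := by omega
        have : (S ℝ (k : ℤ)).eval (2 * cos θ) + (S ℝ ((k : ℤ) - 1)).eval (2 * cos θ) = 0 := by
          have hkθ : ((k : ℝ) + 1) * θ = 2 * π - k * θ := by
            have : (m : ℝ) = 2 * k + 1 := by exact_mod_cast hk
            rw [this] at hmθ; linarith
          rw [hS, hS]; push_cast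
          rw [sub_add_cancel, hkθ, sin_two_pi_sub, neg_div, neg_add_cancel]
        rw [e1, e2, e3, e4, this, mul_zero, mul_zero]
        exact ⟨rfl, rfl⟩
    ext z
    rw [reflection_mul_reflection_pow_apply hf hg m z (2 * cos θ) ht, h1.1, h1.2]
    simp

end Module

/-! ### Geometric representation and visual subgroups -/

namespace CoxeterSystem

open Module Real

variable {B : Type*} (M : CoxeterMatrix B)

/-- The linear form defining a simple reflection in the geometric representation. -/
noncomputable def simpleCoroot (i : B) : Dual ℝ (B →₀ ℝ) :=
  Finsupp.linearCombination ℝ (fun j => -2 * cos (π / M i j))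

theorem simpleCoroot_single (i j : B) :
    simpleCoroot M i (Finsupp.single j 1) = -2 * cos (π / M i j) := by
  simp [simpleCoroot]

theorem simpleCoroot_single_self (i : B) : simpleCoroot M i (Finsupp.single i 1) = 2 := by
  simp [simpleCoroot_single]

theorem isLiftable_reflection_simpleCoroot :
    M.IsLiftable (fun i => reflection (simpleCoroot_single_self M i)) := by
  intro i j
  rcases eq_or_ne i j with rfl | hij
  · rw [M.diagonal, pow_one]
    exact inv_mul_cancel (reflection (simpleCoroot_single_self M i))
  -- The entry `0` encodes an infinite order, which imposes no relation.
  · rcases eq_or_ne (M i j) 0 with h0 | h0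
    · rw [h0, pow_zero]
    · have h1 := M.off_diagonal i j hij
      exact reflection_mul_reflection_pow_eq_one _ _ (by omega) (simpleCoroot_single M i j)
        (by rw [simpleCoroot_single, M.symmetric])

variable {M} {W : Type*} [Group W] (cs : CoxeterSystem M W)

/-- The geometric representation of a Coxeter group. -/
noncomputable def geometricRep : W →* ((B →₀ ℝ) ≃ₗ[ℝ] (B →₀ ℝ)) :=
  cs.lift ⟨_, isLiftable_reflection_simpleCoroot M⟩

theorem geometricRep_simple (i : B) (z : B →₀ ℝ) :
    cs.geometricRep (cs.simple i) z = z - simpleCoroot M i z • Finsupp.single i 1 := by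
  rw [geometricRep, cs.lift_apply_simple, reflection_apply]

/-- Each simple reflection changes only its own coordinate. -/
theorem geometricRep_apply_of_mem_closure {I : Set B} {g : W}
    (hg : g ∈ Subgroup.closure (cs.simple '' I)) {k : B} (hk : k ∉ I) (z : B →₀ ℝ) :
    cs.geometricRep g z k = z k := by
  induction hg using Subgroup.closure_induction generalizing z with
  | mem x hx =>
    obtain ⟨i, hi, rfl⟩ := hx
    have hik : i ≠ k := fun h => hk (h ▸ hi)
    simp [geometricRep_simple, hik]
  | one => simp
  | mul x y _ _ hx hy => rw [map_mul, LinearEquiv.mul_apply, hx, hy]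
  | inv x _ hx =>
    rw [← hx, ← LinearEquiv.mul_apply, ← map_mul, mul_inv_cancel, map_one]
    rfl

/-- A simple reflection lies in the visual subgroup generated by a set of simple reflections only
if it belongs to the set. -/
theorem mem_of_mem_closure_simple {R : Set W} (hR : R ⊆ Set.range cs.simple) {s : W}
    (hs : s ∈ Set.range cs.simple) (h : s ∈ Subgroup.closure R) : s ∈ R := by
  obtain ⟨k, rfl⟩ := hs
  by_contra hk
  rw [← Set.image_preimage_eq_of_subset hR] at h
  -- The reflection negates its own root, so it does not fix the `k`-th coordinate `1`.
  have h1 := cs.geometricRep_apply_of_mem_closure (k := k) h hk (Finsupp.single k 1)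
  rw [geometricRep_simple, simpleCoroot_single_self] at h1
  norm_num at h1

theorem subset_of_closure_le {R R' : Set W} (hR : R ⊆ Set.range cs.simple)
    (hR' : R' ⊆ Set.range cs.simple) (h : Subgroup.closure R ≤ Subgroup.closure R') : R ⊆ R' :=
  fun _ hs => cs.mem_of_mem_closure_simple hR' (hR hs) (h (Subgroup.subset_closure hs))

end CoxeterSystem

/-! ### Amalgamated products -/

namespace Monoid.PushoutI

variable {ι : Type*} {G : ι → Type*} [∀ i, Group (G i)] {H : Type*} [Group H] {φ : ∀ i, H →* G i}

/-- In an amalgamated product, the product of two elements of different factors outside the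
amalgamated subgroup has infinite order. -/
theorem not_isOfFinOrder_of_mul_of (hφ : ∀ i, Function.Injective (φ i)) {i j : ι} (hij : i ≠ j)
    {a : G i} {b : G j} (ha : a ∉ (φ i).range) (hb : b ∉ (φ j).range) :
    ¬ IsOfFinOrder (of i a * of j b : PushoutI φ) := by
  -- The `n`-th power is an alternating reduced word. Its first index is tracked so that another `a
  -- b` can be prepended.
  have key (n : ℕ) : ∃ w : CoprodI.Word G, Reduced φ w ∧ w.toList.length = 2 * n ∧
      (∀ l ∈ w.toList.head?, l.1 = i) ∧
      w.prod = (CoprodI.of a * CoprodI.of b) ^ n := by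
    induction n with
    | zero => exact ⟨.empty, by simp [Reduced, CoprodI.Word.empty], rfl,
        by simp [CoprodI.Word.empty], by simp⟩
    | succ n ih =>
      obtain ⟨w, hw, hl, hh, hp⟩ := ih
      refine ⟨⟨⟨i, a⟩ :: ⟨j, b⟩ :: w.toList, ?_, ?_⟩, ?_, ?_, by simp, ?_⟩
      · simp only [List.mem_cons, forall_eq_or_imp]
        exact ⟨fun h => ha (h ▸ one_mem _), fun h => hb (h ▸ one_mem _), w.ne_one⟩
      · refine List.IsChain.cons_cons hij (List.isChain_cons.2 ⟨fun l hl => ?_, w.chain_ne⟩)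
        rw [hh l hl]
        exact hij.symm
      · simp only [Reduced, List.mem_cons, forall_eq_or_imp]
        exact ⟨ha, hb, hw⟩
      · simp [hl]; ring
      · rw [pow_succ', ← hp]
        simp [CoprodI.Word.prod, mul_assoc]
  intro hfin
  obtain ⟨n, hn, h1⟩ := isOfFinOrder_iff_pow_eq_one.1 hfin
  obtain ⟨w, hw, hl, -, hp⟩ := key n
  have : w = .empty := hw.eq_empty_of_mem_range hφ (by
    rw [hp, map_pow, map_mul, ofCoprodI_of, ofCoprodI_of, h1]; exact one_mem _)
  subst this
  simp [CoprodI.Word.empty] at hl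
  omega

end Monoid.PushoutI

namespace Subgroup

open Monoid

variable {W : Type*} [Group W] {H : Bool → Subgroup W} {E : Subgroup W} (hE : ∀ i, E ≤ H i)

/-- The amalgam of two subgroups of a group over a common subgroup. -/
abbrev Amalgam : Type _ := PushoutI (fun i => inclusion (hE i))

/-- Two factors of an amalgam meet only in the base; a map compatible with the factors suffices to
pull this back, and `f` need not be an isomorphism. -/
theorem mem_of_mem_amalgam_factors {hE : ∀ i, E ≤ H i} (f : W →* Amalgam hE)
    (hf : ∀ i (h : H i), f h = PushoutI.of i h) {i j : Bool} (hij : i ≠ j) {g : W} (hi : g ∈ H i)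
    (hj : g ∈ H j) : g ∈ E := by
  have hinj : ∀ i, Function.Injective (inclusion (hE i)) := fun i => inclusion_injective (hE i)
  have h1 : f g ∈ (PushoutI.base (fun i => inclusion (hE i))).range := by
    rw [← PushoutI.inf_of_range_eq_base_range hinj hij]
    exact ⟨⟨⟨g, hi⟩, (hf i ⟨g, hi⟩).symm⟩, ⟨⟨g, hj⟩, (hf j ⟨g, hj⟩).symm⟩⟩
  obtain ⟨e, he⟩ := h1
  rw [← PushoutI.of_apply_eq_base _ i, hf i ⟨g, hi⟩] at he
  have heg : (e : W) = g := congrArg Subtype.val (PushoutI.of_injective hinj i he)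
  exact heg ▸ e.2

theorem not_isOfFinOrder_mul_of_amalgam {hE : ∀ i, E ≤ H i} (f : W →* Amalgam hE)
    (hf : ∀ i (h : H i), f h = PushoutI.of i h) {i j : Bool} (hij : i ≠ j) {a b : W} (hai : a ∈ H i)
    (haE : a ∉ E) (hbj : b ∈ H j) (hbE : b ∉ E) : ¬ IsOfFinOrder (a * b) := by
  intro h
  have h1 := f.isOfFinOrder h
  rw [map_mul, hf i ⟨a, hai⟩, hf j ⟨b, hbj⟩] at h1
  refine PushoutI.not_isOfFinOrder_of_mul_of (fun i => inclusion_injective (hE i)) hij ?_ ?_ h1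
  · rintro ⟨e, he⟩
    have hea : (e : W) = a := congrArg Subtype.val he
    exact haE (hea ▸ e.2)
  · rintro ⟨e, he⟩
    have hea : (e : W) = b := congrArg Subtype.val he
    exact hbE (hea ▸ e.2)

end Subgroup

/-! ### Cuts of a tree -/

namespace GraphOfGroups

variable (G : GraphOfGroups.{u, v, w, x})

/-- The simple graph on the vertices spanned by a set of edges. -/
abbrev edgeGraph (T : Set G.E) : SimpleGraph G.V :=
  SimpleGraph.fromEdgeSet ((fun e => s(G.src e, G.tgt e)) '' T)

/-- The two-colouring `c` of the vertices is a cut along `e`: the edge `e` is the only one whose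
ends have different colours. -/
structure IsCut (e : G.E) (c : G.V → Bool) : Prop where
  ne : c (G.src e) ≠ c (G.tgt e)
  eq_of_ne : ∀ e', e' ≠ e → c (G.src e') = c (G.tgt e')

variable {G}

theorem IsCut.eq_src_or_eq_tgt {e : G.E} {c : G.V → Bool} (hc : G.IsCut e c) (b : Bool) :
    b = c (G.src e) ∨ b = c (G.tgt e) := by
  have := hc.ne
  revert this
  cases c (G.src e) <;> cases c (G.tgt e) <;> cases b <;> simp

/-- In a tree, a set of vertices containing `p` and not `q` has a boundary edge separating `p`
from `q`. -/
theorem IsMaximalTree.exists_boundary_cut (hT : G.IsMaximalTree Set.univ) {p q : G.V}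
    {A : Set G.V} (hp : p ∈ A) (hq : q ∉ A) :
    ∃ e c, G.IsCut e c ∧ c p ≠ c q ∧
      (G.src e ∈ A ∧ G.tgt e ∉ A ∨ G.tgt e ∈ A ∧ G.src e ∉ A) := by
  classical
  obtain ⟨w, hw, -⟩ := hT.isTree.existsUnique_path p q
  obtain ⟨d, hd, hd1, hd2⟩ := w.exists_boundary_dart A hp hq
  obtain ⟨⟨e, -, he⟩, -⟩ := (SimpleGraph.fromEdgeSet_adj _).1 d.adj
  have hmem : s(G.src e, G.tgt e) ∈ w.edges := by
    rw [show s(G.src e, G.tgt e) = d.edge from he]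
    exact List.mem_map_of_mem hd
  -- By uniqueness of paths, deleting this edge disconnects `p` from `q`. The colouring is
  -- reachability from `p` in what remains.
  set Γ' := (G.edgeGraph Set.univ).deleteEdges {s(G.src e, G.tgt e)} with hΓ'
  have hle : Γ' ≤ G.edgeGraph Set.univ := SimpleGraph.deleteEdges_le _
  have hedge (e' : G.E) (hne : e' ≠ e) : Γ'.Adj (G.src e') (G.tgt e') := by
    rw [hΓ', SimpleGraph.deleteEdges_adj, SimpleGraph.fromEdgeSet_adj]
    refine ⟨⟨⟨e', trivial, rfl⟩, hT.no_loop e' trivial⟩, fun h => hne ?_⟩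
    exact hT.no_parallel trivial trivial h
  have hpq : ¬ Γ'.Reachable p q := by
    rintro ⟨w'⟩
    have h1 : (w'.toPath.1.mapLe hle) = w := hT.isTree.existsUnique_path p q |>.unique
      (w'.toPath.2.mapLe hle) hw
    rw [← h1, SimpleGraph.Walk.edges_mapLe_eq_edges] at hmem
    have := SimpleGraph.Walk.edges_subset_edgeSet _ hmem
    rw [SimpleGraph.mem_edgeSet, hΓ', SimpleGraph.deleteEdges_adj] at this
    exact this.2 rfl
  have hcut (e' : G.E) (hne : e' ≠ e) :
      Γ'.Reachable p (G.src e') ↔ Γ'.Reachable p (G.tgt e') :=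
    ⟨fun h => h.trans (hedge e' hne).reachable, fun h => h.trans (hedge e' hne).reachable.symm⟩
  refine ⟨e, fun r => decide (Γ'.Reachable p r), ⟨fun heq => hpq ?_, fun e' hne => ?_⟩, ?_, ?_⟩
  -- If the ends of `e` had one colour, no edge would change colour and `q` would be reachable.
  · have hcross : Γ'.Reachable p (G.src e) ↔ Γ'.Reachable p (G.tgt e) := by simpa using heq
    by_contra hpq
    obtain ⟨d', -, h1, h2⟩ := w.exists_boundary_dart {r | Γ'.Reachable p r} .rfl hpq
    obtain ⟨⟨e', -, he'⟩, -⟩ := (SimpleGraph.fromEdgeSet_adj _).1 d'.adj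
    have h3 : Γ'.Reachable p (G.src e') ↔ Γ'.Reachable p (G.tgt e') := by
      by_cases hee : e' = e
      · rwa [hee]
      · exact hcut e' hee
    rcases Sym2.eq_iff.1 he' with ⟨h4, h5⟩ | ⟨h4, h5⟩
    · rw [h4, h5] at h3; exact h2 (h3.1 h1)
    · rw [h4, h5] at h3; exact h2 (h3.2 h1)
  · simpa using hcut e' hne
  · simp [hpq]
  · rcases Sym2.eq_iff.1 (show s(G.src e, G.tgt e) = s(d.fst, d.snd) from he) with
      ⟨h4, h5⟩ | ⟨h4, h5⟩
    · rw [h4, h5]; exact Or.inl ⟨hd1, hd2⟩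
    · rw [h4, h5]; exact Or.inr ⟨hd1, hd2⟩

/-- A cut separating the two ends of `e` can only be a cut along `e`. -/
theorem IsMaximalTree.exists_cut (hT : G.IsMaximalTree Set.univ) (e : G.E) :
    ∃ c, G.IsCut e c := by
  obtain ⟨e', c, hc, hne, -⟩ := hT.exists_boundary_cut (A := {G.src e}) rfl
    (hT.no_loop e trivial).symm
  by_cases h : e = e'
  · exact ⟨c, h ▸ hc⟩
  · exact absurd (hc.eq_of_ne e h) hne

variable (G)

/-- The universal property of the fundamental group of a graph of groups. -/
def FundamentalGroup.lift {T : Set G.E} {K : Type*} [Group K] (φ : ∀ p, G.vGroup p →* K)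
    (t : G.E → K)
    (h : ∀ e g, φ (G.src e) (G.toSrc e g) * t e = t e * φ (G.tgt e) (G.toTgt e g))
    (hT : ∀ e ∈ T, t e = 1) : G.FundamentalGroup T →* K :=
  QuotientGroup.lift _ (Monoid.Coprod.lift (Monoid.CoprodI.lift φ) (FreeGroup.lift t)) (by
    refine Subgroup.normalClosure_le_normal ?_
    rintro r (⟨e, g, rfl⟩ | ⟨e, he, rfl⟩)
    · simp [MonoidHom.mem_ker, letter, ofVertex, mul_assoc, inv_mul_eq_iff_eq_mul]
      rw [← mul_assoc, h, mul_inv_cancel_right]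
    · simp [MonoidHom.mem_ker, letter, hT e he])

end GraphOfGroups

/-! ### Splittings of the group along the edges of the tree -/

namespace GraphOfGroupsDecomposition

variable {W : Type y} [Group W] (Ψ : GraphOfGroupsDecomposition.{u, v, w, x, y} W)

/-- The element of the decomposed group given by an edge. -/
def letter (e : Ψ.gog.E) : W :=
  Ψ.iso (QuotientGroup.mk' (Subgroup.normalClosure (Ψ.gog.relators Ψ.tree)) (Ψ.gog.letter e))

variable {Ψ}

theorem exists_hom {K : Type*} [Group K] (φ : ∀ p, Ψ.gog.vGroup p →* K) (t : Ψ.gog.E → K)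
    (h : ∀ e g, φ (Ψ.gog.src e) (Ψ.gog.toSrc e g) * t e =
      t e * φ (Ψ.gog.tgt e) (Ψ.gog.toTgt e g))
    (hT : ∀ e ∈ Ψ.tree, t e = 1) :
    ∃ f : W →* K, (∀ p g, f (Ψ.vertexHom p g) = φ p g) ∧ ∀ e, f (Ψ.letter e) = t e := by
  refine ⟨(GraphOfGroups.FundamentalGroup.lift Ψ.gog φ t h hT).comp Ψ.iso.symm.toMonoidHom,
    fun p g => ?_, fun e => ?_⟩
  · simp [GraphOfGroups.FundamentalGroup.lift, vertexHom, GraphOfGroups.ofVertex]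
  · simp [GraphOfGroups.FundamentalGroup.lift, letter, GraphOfGroups.letter]

/-- A group generated by elements of finite order splits only as a tree of groups. -/
theorem tree_eq_univ {S : Set W} (hS : Subgroup.closure S = ⊤) (hfin : ∀ s ∈ S, IsOfFinOrder s) :
    Ψ.tree = Set.univ := by
  classical
  refine Set.eq_univ_of_forall fun e => ?_
  by_contra he
  -- An edge off the tree has a free stable letter, which can be sent to a generator of `ℤ` with
  -- everything else killed. As `ℤ` is torsion-free, this map would be trivial on `S`.
  obtain ⟨f, -, hf⟩ := Ψ.exists_hom (K := Multiplicative ℤ) (fun p => 1)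
    (Pi.mulSingle e (Multiplicative.ofAdd 1)) (by simp)
    (fun e' he' => Pi.mulSingle_eq_of_ne (by rintro rfl; exact he he') _)
  have h1 : f = 1 := by
    refine MonoidHom.eq_of_eqOn_dense hS fun s hs => ?_
    exact (isOfFinOrder_iff_eq_one _).1 (f.isOfFinOrder (hfin s hs))
  have h2 := hf e
  rw [h1, Pi.mulSingle_eq_same] at h2
  exact one_ne_zero (Multiplicative.ofAdd.injective h2.symm)

theorem iSup_vertexSubgroup (hT : Ψ.tree = Set.univ) : ⨆ p, Ψ.vertexSubgroup p = ⊤ := by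
  refine (Subgroup.eq_top_iff' _).2 fun g => ?_
  obtain ⟨x, rfl⟩ := Ψ.iso.surjective g
  obtain ⟨x, rfl⟩ := QuotientGroup.mk'_surjective _ x
  set N := Subgroup.normalClosure (Ψ.gog.relators Ψ.tree)
  set F := Ψ.iso.toMonoidHom.comp (QuotientGroup.mk' N) with hF
  change F x ∈ _
  induction x using Monoid.Coprod.induction_on with
  | inl m =>
    induction m using Monoid.CoprodI.induction_on with
    | one => rw [map_one, map_one]; exact one_mem _
    | of p g => exact Subgroup.mem_iSup_of_mem p ⟨g, rfl⟩
    | mul a b ha hb => rw [map_mul, map_mul]; exact mul_mem ha hb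
  | inr n =>
    have h1 : F.comp Monoid.Coprod.inr = 1 := by
      ext e
      have : Ψ.gog.letter e ∈ N :=
        Subgroup.subset_normalClosure (Or.inr ⟨e, hT ▸ Set.mem_univ e, rfl⟩)
      change Ψ.iso (QuotientGroup.mk' N (Ψ.gog.letter e)) = 1
      rw [QuotientGroup.mk'_apply, (QuotientGroup.eq_one_iff _).2 this, map_one]
    have h2 := DFunLike.congr_fun h1 n
    rw [MonoidHom.comp_apply, MonoidHom.one_apply] at h2
    rw [h2]
    exact one_mem _
  | mul a b ha hb => rw [map_mul]; exact mul_mem ha hb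

theorem edgeSubgroup_le_src (e : Ψ.gog.E) :
    Ψ.edgeSubgroup e ≤ Ψ.vertexSubgroup (Ψ.gog.src e) := by
  rintro _ ⟨g, rfl⟩
  exact ⟨_, rfl⟩

theorem edgeSubgroup_le_tgt {e : Ψ.gog.E} (he : e ∈ Ψ.tree) :
    Ψ.edgeSubgroup e ≤ Ψ.vertexSubgroup (Ψ.gog.tgt e) := by
  rw [Ψ.edgeSubgroup_eq_of_mem_tree e he]
  rintro _ ⟨g, rfl⟩
  exact ⟨_, rfl⟩

variable (Ψ) in
/-- The subgroup generated by the vertex groups of one colour. -/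
def sideSubgroup (c : Ψ.gog.V → Bool) (b : Bool) : Subgroup W :=
  ⨆ (p) (_ : c p = b), Ψ.vertexSubgroup p

theorem vertexSubgroup_le_sideSubgroup (c : Ψ.gog.V → Bool) (p : Ψ.gog.V) :
    Ψ.vertexSubgroup p ≤ Ψ.sideSubgroup c (c p) :=
  le_iSup₂_of_le p rfl le_rfl

theorem edgeSubgroup_le_sideSubgroup {e : Ψ.gog.E} (he : e ∈ Ψ.tree) {c : Ψ.gog.V → Bool}
    (hc : Ψ.gog.IsCut e c) (b : Bool) : Ψ.edgeSubgroup e ≤ Ψ.sideSubgroup c b := by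
  rcases hc.eq_src_or_eq_tgt b with rfl | rfl
  · exact (Ψ.edgeSubgroup_le_src e).trans (Ψ.vertexSubgroup_le_sideSubgroup c _)
  · exact (Ψ.edgeSubgroup_le_tgt he).trans (Ψ.vertexSubgroup_le_sideSubgroup c _)

/-- A tree of groups is an amalgamated product along each of its edges. -/
theorem exists_hom_amalgam (hT : Ψ.tree = Set.univ) {e : Ψ.gog.E} {c : Ψ.gog.V → Bool}
    (hc : Ψ.gog.IsCut e c)
    (hle : ∀ b, Ψ.edgeSubgroup e ≤ Ψ.sideSubgroup c b) :
    ∃ f : W →* Subgroup.Amalgam hle, ∀ b (h : Ψ.sideSubgroup c b),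
      f h = Monoid.PushoutI.of b h := by
  have hcongr {i j : Bool} (hij : i = j) {a b : W} (hab : a = b) (ha : a ∈ Ψ.sideSubgroup c i)
      (hb : b ∈ Ψ.sideSubgroup c j) :
      (Monoid.PushoutI.of i ⟨a, ha⟩ : Subgroup.Amalgam hle) = Monoid.PushoutI.of j ⟨b, hb⟩ := by
    subst hij hab; rfl
  have hmem (p : Ψ.gog.V) (g : Ψ.gog.vGroup p) : Ψ.vertexHom p g ∈ Ψ.sideSubgroup c (c p) :=
    Ψ.vertexSubgroup_le_sideSubgroup c p ⟨g, rfl⟩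
  -- Each vertex group goes to the factor of its colour. Edges other than `e` stay within one
  -- factor; along `e` the two images agree through the base.
  obtain ⟨f, hf, -⟩ := Ψ.exists_hom (K := Subgroup.Amalgam hle)
    (fun p => (Monoid.PushoutI.of (c p)).comp
      ((Ψ.vertexHom p).codRestrict (Ψ.sideSubgroup c (c p)) (hmem p))) (fun _ => 1) (by
      intro e' g
      have heq := Ψ.vertexHom_toSrc_eq_of_mem_tree e' (hT ▸ Set.mem_univ e') g
      simp only [mul_one, one_mul, MonoidHom.comp_apply]
      by_cases hee : e' = e
      · subst hee
        have key (i : Bool) (a : W) (ha : a ∈ Ψ.sideSubgroup c i) (hE : a ∈ Ψ.edgeSubgroup e') :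
            (Monoid.PushoutI.of i ⟨a, ha⟩ : Subgroup.Amalgam hle) =
              Monoid.PushoutI.base _ ⟨a, hE⟩ :=
          Monoid.PushoutI.of_apply_eq_base (fun b => Subgroup.inclusion (hle b)) i ⟨a, hE⟩
        have hE : Ψ.vertexHom _ (Ψ.gog.toSrc e' g) ∈ Ψ.edgeSubgroup e' := ⟨g, rfl⟩
        refine (key _ _ (hmem _ _) hE).trans (Eq.trans ?_ (key _ _ (hmem _ _) (heq ▸ hE)).symm)
        exact congrArg _ (Subtype.ext heq)
      · exact hcongr (hc.eq_of_ne e' hee) heq (hmem _ _) (hmem _ _)) (by simp)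
  refine ⟨f, fun b h => ?_⟩
  -- The locus where the two maps agree is a subgroup containing the vertex groups that generate the
  -- side.
  have hside : Ψ.sideSubgroup c b ≤ ((f.comp (Ψ.sideSubgroup c b).subtype).eqLocus
      (Monoid.PushoutI.of (φ := fun i => Subgroup.inclusion (hle i)) b)).map (Ψ.sideSubgroup c b).subtype := by
    refine iSup₂_le fun p hp => ?_
    subst hp
    rintro _ ⟨g, rfl⟩
    exact ⟨⟨_, hmem p g⟩, hf p g, rfl⟩
  obtain ⟨h', hh', hval⟩ := hside h.2
  obtain rfl : h' = h := Subtype.ext hval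
  exact hh'

theorem mem_edgeSubgroup_of_cut (hT : Ψ.tree = Set.univ) {e : Ψ.gog.E} {c : Ψ.gog.V → Bool}
    (hc : Ψ.gog.IsCut e c) {b b' : Bool} (hb : b ≠ b') {g : W} (h : g ∈ Ψ.sideSubgroup c b)
    (h' : g ∈ Ψ.sideSubgroup c b') : g ∈ Ψ.edgeSubgroup e := by
  obtain ⟨f, hf⟩ := Ψ.exists_hom_amalgam hT hc
    (Ψ.edgeSubgroup_le_sideSubgroup (hT ▸ Set.mem_univ e) hc)
  exact Subgroup.mem_of_mem_amalgam_factors f hf hb h h'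

theorem not_isOfFinOrder_mul_of_cut (hT : Ψ.tree = Set.univ) {e : Ψ.gog.E} {c : Ψ.gog.V → Bool}
    (hc : Ψ.gog.IsCut e c) {b b' : Bool} (hb : b ≠ b') {g g' : W} (h : g ∈ Ψ.sideSubgroup c b)
    (he : g ∉ Ψ.edgeSubgroup e) (h' : g' ∈ Ψ.sideSubgroup c b') (he' : g' ∉ Ψ.edgeSubgroup e) :
    ¬ IsOfFinOrder (g * g') := by
  obtain ⟨f, hf⟩ := Ψ.exists_hom_amalgam hT hc
    (Ψ.edgeSubgroup_le_sideSubgroup (hT ▸ Set.mem_univ e) hc)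
  exact Subgroup.not_isOfFinOrder_mul_of_amalgam f hf hb h he h' he'

end GraphOfGroupsDecomposition

/-! ### Embedding of the vertex groups -/

section RegularAction

variable {G : Type*} [Group G] {K : Type*}

/-- The free action of `G` on `K` transported from the left translations on `G × K`. -/
def translationHom (θ : G × K ≃ K) : G →* Equiv.Perm K where
  toFun g := (θ.symm.trans ((Equiv.mulLeft g).prodCongr (Equiv.refl K))).trans θ
  map_one' := by ext k; simp
  map_mul' a b := by
    ext k
    obtain ⟨⟨h, k⟩, rfl⟩ := θ.surjective k
    simp [mul_assoc]

theorem translationHom_apply (θ : G × K ≃ K) (g h : G) (k : K) :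
    translationHom θ g (θ (h, k)) = θ (g * h, k) := by
  simp [translationHom]

theorem translationHom_injective (θ : G × K ≃ K) [Nonempty K] :
    Function.Injective (translationHom θ) := by
  intro a b hab
  obtain ⟨k⟩ := ‹Nonempty K›
  have := DFunLike.congr_fun hab (θ (1, k))
  simpa [translationHom_apply] using this

/-- The restriction of a transported translation action to a subgroup is again one, when `K` absorbs
the subsets of `G`. -/
theorem exists_equiv_translationHom_comp {E : Type*} [Group E] {ι : E →* G}
    (hι : Function.Injective ι) (θ : G × K ≃ K)
    (hK : ∀ t : Set G, t.Nonempty → Nonempty (t × K ≃ K)) :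
    ∃ β : E × K ≃ K, ∀ g h k, translationHom θ (ι g) (β (h, k)) = β (g * h, k) := by
  -- A transversal `t` gives `G × K ≃ E × (t × K)`, and `K` absorbs `t`.
  obtain ⟨t, ht, h1⟩ := ι.range.exists_isComplement_right 1
  obtain ⟨κ⟩ := hK t ⟨1, h1⟩
  refine ⟨((((MonoidHom.ofInjective hι).toEquiv.prodCongr κ.symm).trans
    (Equiv.prodAssoc _ _ _).symm).trans ((Equiv.ofBijective _ ht).prodCongr (Equiv.refl K))).trans θ,
    fun g h k => ?_⟩
  change translationHom θ (ι g) (θ (ι h * (κ.symm k).1, (κ.symm k).2)) =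
    θ (ι (g * h) * (κ.symm k).1, (κ.symm k).2)
  rw [translationHom_apply, map_mul, mul_assoc]

theorem nonempty_prod_equiv_of_embedding {α κ : Type*} [Nonempty α] [Infinite κ] (f : α ↪ κ) :
    Nonempty (α × κ ≃ κ) := by
  obtain ⟨a⟩ := ‹Nonempty α›
  have e : κ × κ ≃ κ := (Cardinal.eq.1 (by
    rw [Cardinal.mk_prod, Cardinal.lift_id, Cardinal.mul_eq_self (Cardinal.aleph0_le_mk κ)])).some
  exact Function.Embedding.antisymm ((f.prodMap (.refl κ)).trans e.toEmbedding)
    ⟨fun k => (a, k), fun _ _ h => (Prod.mk.inj h).2⟩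

end RegularAction

namespace GraphOfGroups

variable {G : GraphOfGroups.{u, v, w, x}}

/-- On a tree every group-valued function on the edges is a coboundary. -/
theorem IsMaximalTree.exists_potential (hT : G.IsMaximalTree Set.univ) {P : Type*} [Group P]
    (τ : G.E → P) : ∃ σ : G.V → P, ∀ e, σ (G.src e) * τ e = σ (G.tgt e) := by
  classical
  have huniq {e e' : G.E} (h : s(G.src e, G.tgt e) = s(G.src e', G.tgt e')) : e = e' :=
    hT.no_parallel trivial trivial h
  let val (p q : G.V) : P := if h : ∃ e, G.src e = p ∧ G.tgt e = q then τ h.choose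
    else if h : ∃ e, G.src e = q ∧ G.tgt e = p then (τ h.choose)⁻¹ else 1
  have hval (e : G.E) : val (G.src e) (G.tgt e) = τ e := by
    have h : ∃ e', G.src e' = G.src e ∧ G.tgt e' = G.tgt e := ⟨e, rfl, rfl⟩
    have he : h.choose = e := huniq (by rw [h.choose_spec.1, h.choose_spec.2])
    simp only [val]
    rw [dif_pos h, he]
  have hval' (e : G.E) : val (G.tgt e) (G.src e) = (τ e)⁻¹ := by
    have h : ∃ e', G.src e' = G.src e ∧ G.tgt e' = G.tgt e := ⟨e, rfl, rfl⟩
    have he : h.choose = e := huniq (by rw [h.choose_spec.1, h.choose_spec.2])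
    have hn : ¬ ∃ e', G.src e' = G.tgt e ∧ G.tgt e' = G.src e := by
      rintro ⟨e', h1, h2⟩
      obtain rfl : e' = e := huniq (by rw [h1, h2, Sym2.eq_swap])
      exact hT.no_loop e' trivial h1
    simp only [val]
    rw [dif_neg hn, dif_pos h, he]
  obtain ⟨r⟩ := hT.isTree.connected.nonempty
  choose path hpath _ using fun q => hT.isTree.existsUnique_path r q
  have hconcat {p q : G.V} (hadj : (G.edgeGraph Set.univ).Adj p q) (h : p ∈ (path q).support) :
      ((path q).darts.map fun d => val d.fst d.snd).prod =
        ((path p).darts.map fun d => val d.fst d.snd).prod * val p q := by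
    rw [hT.isTree.isAcyclic.path_concat (hpath p) (hpath q) hadj h, SimpleGraph.Walk.darts_concat]
    simp
  -- The potential is the product along the path from a root. For adjacent vertices, one of the two
  -- paths extends the other by the edge.
  refine ⟨fun q => ((path q).darts.map fun d => val d.fst d.snd).prod, fun e => ?_⟩
  have hadj : (G.edgeGraph Set.univ).Adj (G.src e) (G.tgt e) :=
    (SimpleGraph.fromEdgeSet_adj _).2 ⟨⟨e, trivial, rfl⟩, hT.no_loop e trivial⟩
  by_cases h : G.src e ∈ (path (G.tgt e)).support
  · beta_reduce
    rw [hconcat hadj h, hval]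
  · have h' := hT.isTree.isAcyclic.mem_support_of_ne_mem_support_of_adj_of_isPath
      (hpath _) (hpath _) hadj h
    beta_reduce
    rw [hconcat hadj.symm h', hval', inv_mul_cancel_right]

end GraphOfGroups

namespace GraphOfGroupsDecomposition

variable {W : Type y} [Group W] {Ψ : GraphOfGroupsDecomposition.{u, v, w, x, y} W}

/-- The vertex groups of a tree of groups embed in its fundamental group. -/
theorem vertexHom_injective (hT : Ψ.tree = Set.univ) (p : Ψ.gog.V) :
    Function.Injective (Ψ.vertexHom p) := by
  -- One infinite set, large enough for every vertex group to act freely on it by `translationHom`.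
  let K := (Σ q, Ψ.gog.vGroup q) × ℕ
  have : Nonempty (Σ q, Ψ.gog.vGroup q) := ⟨⟨p, 1⟩⟩
  let emb (q : Ψ.gog.V) : Ψ.gog.vGroup q ↪ K :=
    ⟨fun g => (⟨q, g⟩, 0), fun a b h => by simpa [K] using h⟩
  let θ (q : Ψ.gog.V) : Ψ.gog.vGroup q × K ≃ K := (nonempty_prod_equiv_of_embedding (emb q)).some
  have hK (q : Ψ.gog.V) (t : Set (Ψ.gog.vGroup q)) (ht : t.Nonempty) : Nonempty (t × K ≃ K) :=
    have := ht.to_subtype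
    nonempty_prod_equiv_of_embedding ((Function.Embedding.subtype _).trans (emb q))
  -- Both restrictions to an edge group are copies of translation on `eGroup e × K`, so `β ∘ γ⁻¹`
  -- intertwines them.
  choose β hβ using fun e =>
    exists_equiv_translationHom_comp (Ψ.gog.toSrc_injective e) (θ (Ψ.gog.src e)) (hK _)
  choose γ hγ using fun e =>
    exists_equiv_translationHom_comp (Ψ.gog.toTgt_injective e) (θ (Ψ.gog.tgt e)) (hK _)
  have hτ (e : Ψ.gog.E) (g : Ψ.gog.eGroup e) :
      translationHom (θ _) (Ψ.gog.toSrc e g) * ((γ e).symm.trans (β e) : Equiv.Perm K) =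
        ((γ e).symm.trans (β e) : Equiv.Perm K) * translationHom (θ _) (Ψ.gog.toTgt e g) := by
    ext1 k
    obtain ⟨⟨h, k⟩, rfl⟩ := (γ e).surjective k
    rw [Equiv.Perm.mul_apply, Equiv.Perm.mul_apply, hγ]
    simp only [Equiv.trans_apply, Equiv.symm_apply_apply]
    rw [hβ]
  -- Conjugating the vertex actions by `σ` absorbs the intertwiners, so every stable letter can act
  -- trivially.
  obtain ⟨σ, hσ⟩ := (hT ▸ Ψ.isMaximalTree).exists_potential
    (fun e => ((γ e).symm.trans (β e) : Equiv.Perm K))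
  obtain ⟨f, hf, -⟩ := Ψ.exists_hom
    (fun q => (MulAut.conj (σ q)).toMonoidHom.comp (translationHom (θ q))) (fun _ => 1) (by
      intro e g
      simp only [mul_one, one_mul, MonoidHom.comp_apply, MulEquiv.toMonoidHom_eq_coe,
        MonoidHom.coe_coe, MulAut.conj_apply]
      rw [← hσ e, mul_inv_rev, mul_assoc (σ _) _ (translationHom _ _), ← hτ e g]
      group) (by simp)
  have hinj : Function.Injective (f ∘ Ψ.vertexHom p) := by
    intro a b hab
    rw [Function.comp_apply, Function.comp_apply, hf, hf] at hab
    exact translationHom_injective _ ((MulAut.conj (σ p)).injective hab)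
  exact hinj.of_comp

theorem IsReduced.edgeSubgroup_ne (hred : Ψ.IsReduced) (hT : Ψ.tree = Set.univ) (e : Ψ.gog.E) :
    Ψ.edgeSubgroup e ≠ Ψ.vertexSubgroup (Ψ.gog.src e) ∧
      Ψ.edgeSubgroup e ≠ Ψ.vertexSubgroup (Ψ.gog.tgt e) := by
  have he : e ∈ Ψ.tree := hT ▸ Set.mem_univ e
  obtain ⟨h1, h2⟩ := hred e (Ψ.isMaximalTree.no_loop e he)
  refine ⟨fun h => h1 fun g => ?_, fun h => h2 fun g => ?_⟩
  · obtain ⟨a, ha⟩ : Ψ.vertexHom _ g ∈ Ψ.edgeSubgroup e := h ▸ ⟨g, rfl⟩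
    exact ⟨a, Ψ.vertexHom_injective hT _ ha⟩
  · rw [Ψ.edgeSubgroup_eq_of_mem_tree e he] at h
    obtain ⟨a, ha⟩ : Ψ.vertexHom _ g ∈
      ((Ψ.vertexHom (Ψ.gog.tgt e)).comp (Ψ.gog.toTgt e)).range := h ▸ ⟨g, rfl⟩
    exact ⟨a, Ψ.vertexHom_injective hT _ ha⟩

end GraphOfGroupsDecomposition

/-! ### Combinatorics of trees of bags -/

namespace CoxeterSeparation

variable {W : Type y} [Group W]

/-- A set which is not separated by a complete subset lies on one side of every separation by a
complete subset. -/
theorem IsSeparation.subset_or_subset {S S₁ S₀ S₂ R : Set W} (h : IsSeparation S S₁ S₀ S₂)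
    (hS₀ : IsComplete S₀) (hRS : R ⊆ S) (hR : ¬ SeparatedByComplete R) : R ⊆ S₁ ∨ R ⊆ S₂ := by
  by_contra hcon
  rw [not_or, Set.not_subset, Set.not_subset] at hcon
  obtain ⟨⟨b, hbR, hb⟩, a, haR, ha⟩ := hcon
  have hu := h.union_eq
  have hi := h.inter_eq
  -- Otherwise the separation restricts to one of `R`.
  refine hR ⟨R ∩ S₀, fun s hs t ht => hS₀ s hs.2 t ht.2, R ∩ S₁, R ∩ S₂, ?_, ?_, ?_, ?_, ?_⟩
  · rw [← Set.inter_union_distrib_left, ← hu, Set.inter_eq_left.2 hRS]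
  · rw [hi]; ext; simp; tauto
  · exact fun a ha b hb => h.infinite_order a ⟨ha.1.2, fun h0 => ha.2 ⟨ha.1.1, h0⟩⟩ b
      ⟨hb.1.2, fun h0 => hb.2 ⟨hb.1.1, h0⟩⟩
  · have haS := hRS haR
    rw [hu] at haS
    exact ⟨a, ⟨haR, haS.resolve_right ha⟩, fun h0 => ha (hi ▸ h0.2).2⟩
  · have hbS := hRS hbR
    rw [hu] at hbS
    exact ⟨b, ⟨hbR, hbS.resolve_left hb⟩, fun h0 => hb (hi ▸ h0.2).1⟩

end CoxeterSeparation

namespace GraphOfGroups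

open CoxeterSeparation

variable {G : GraphOfGroups.{u, v, w, x}} {W : Type y} [Group W]

/-- A tree of subsets ("bags") `R p` of `S` glued along complete subsets `T e`. -/
structure IsCompleteTree (G : GraphOfGroups.{u, v, w, x}) (S : Set W) (R : G.V → Set W)
    (T : G.E → Set W) : Prop where
  isMaximalTree : G.IsMaximalTree Set.univ
  eq_iUnion : S = ⋃ p, R p
  complete : ∀ e, IsComplete (T e)
  ssubset_src : ∀ e, T e ⊂ R (G.src e)
  ssubset_tgt : ∀ e, T e ⊂ R (G.tgt e)
  unseparated : ∀ p, ¬ SeparatedByComplete (R p)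
  inter_subset : ∀ {e c}, G.IsCut e c → ∀ {p q}, c p ≠ c q → R p ∩ R q ⊆ T e
  infinite_order : ∀ {e c}, G.IsCut e c → ∀ {p q}, c p ≠ c q → ∀ a ∈ R p \ T e, ∀ b ∈ R q \ T e,
    ¬ IsOfFinOrder (a * b)

namespace IsCompleteTree

variable {S : Set W} {R : G.V → Set W} {T : G.E → Set W} (h : G.IsCompleteTree S R T)
include h

theorem bag_subset (p : G.V) : R p ⊆ S := h.eq_iUnion ▸ Set.subset_iUnion R p

theorem exists_mem_bag {s : W} (hs : s ∈ S) : ∃ p, s ∈ R p := by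
  rwa [h.eq_iUnion, Set.mem_iUnion] at hs

theorem isSeparation {e : G.E} {c : G.V → Bool} (hc : G.IsCut e c) {p q : G.V} (hpq : c p ≠ c q)
    {a b : W} (ha : a ∈ R p \ T e) (hb : b ∈ R q \ T e) :
    IsSeparation S {s | ∃ r, c r = c p ∧ s ∈ R r} (T e) {s | ∃ r, c r = c q ∧ s ∈ R r} where
  union_eq := by
    ext s
    rw [h.eq_iUnion, Set.mem_iUnion]
    refine ⟨fun ⟨r, hr⟩ => ?_, ?_⟩
    · have : c r = c p ∨ c r = c q := by
        revert hpq
        cases c p <;> cases c q <;> cases c r <;> simp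
      exact this.imp (fun h => ⟨r, h, hr⟩) (fun h => ⟨r, h, hr⟩)
    · rintro (⟨r, -, hr⟩ | ⟨r, -, hr⟩) <;> exact ⟨r, hr⟩
  inter_eq := by
    refine Set.Subset.antisymm (fun s hs => ?_) ?_
    · have key (i : G.V) : ∃ r, c r = c i ∧ s ∈ R r := by
        rcases hc.eq_src_or_eq_tgt (c i) with h1 | h1
        · exact ⟨_, h1.symm, (h.ssubset_src e).1 hs⟩
        · exact ⟨_, h1.symm, (h.ssubset_tgt e).1 hs⟩
      exact ⟨key p, key q⟩
    · rintro s ⟨⟨r, hr, hs⟩, r', hr', hs'⟩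
      exact h.inter_subset hc (p := r) (q := r') (by rwa [hr, hr']) ⟨hs, hs'⟩
  infinite_order := by
    rintro a ⟨⟨r, hr, ha⟩, haT⟩ b ⟨⟨r', hr', hb⟩, hbT⟩
    exact h.infinite_order hc (p := r) (q := r') (by rwa [hr, hr']) a ⟨ha, haT⟩ b ⟨hb, hbT⟩
  left_nonempty := ⟨a, ⟨p, rfl, ha.1⟩, ha.2⟩
  right_nonempty := ⟨b, ⟨q, rfl, hb.1⟩, hb.2⟩

theorem isABSeparator {e : G.E} {c : G.V → Bool} (hc : G.IsCut e c) {p q : G.V} (hpq : c p ≠ c q)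
    {a b : W} (ha : a ∈ R p \ T e) (hb : b ∈ R q \ T e) : IsABSeparator S a b (T e) :=
  ⟨_, _, h.isSeparation hc hpq ha hb, ⟨⟨p, rfl, ha.1⟩, ha.2⟩, ⟨⟨q, rfl, hb.1⟩, hb.2⟩⟩

/-- Distinct bags are incomparable. -/
theorem eq_of_bag_subset {p q : G.V} (hpq : R p ⊆ R q) : p = q := by
  by_contra hne
  -- The edge leaving `p` towards `q` has `R p = R p ∩ R q ⊆ T e`, yet `T e` is proper in `R p`.
  obtain ⟨e, c, hc, hcpq, he⟩ := h.isMaximalTree.exists_boundary_cut (A := {p}) rfl (Ne.symm hne)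
  have h1 : R p ⊆ T e := fun s hs => h.inter_subset hc hcpq ⟨hs, hpq hs⟩
  rcases he with ⟨h2, -⟩ | ⟨h2, -⟩
  · obtain rfl : G.src e = p := h2
    exact (h.ssubset_src e).2 h1
  · obtain rfl : G.tgt e = p := h2
    exact (h.ssubset_tgt e).2 h1

/-- A set which is not separated by a complete subset lies in a bag. -/
theorem exists_subset_bag (hS : S.Finite) {Q : Set W} (hQS : Q ⊆ S)
    (hQ : ¬ SeparatedByComplete Q) : ∃ p, Q ⊆ R p := by
  obtain ⟨p₀⟩ := h.isMaximalTree.isTree.connected.nonempty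
  have hfr : (Set.range fun p => Q ∩ R p).Finite :=
    (hS.subset hQS).finite_subsets.subset (by rintro _ ⟨p, rfl⟩; exact Set.inter_subset_left)
  -- The chosen bag has maximal trace on `Q`; finiteness of `S` is used here.
  obtain ⟨_, ⟨⟨p, rfl⟩, hmax⟩⟩ := hfr.exists_maximal ⟨_, p₀, rfl⟩
  by_contra hcon
  push Not at hcon
  obtain ⟨s, hsQ, hsp⟩ := Set.not_subset.1 (hcon p)
  obtain ⟨q, hsq⟩ := h.exists_mem_bag (hQS hsQ)
  obtain ⟨e, c, hc, hpq, he⟩ := h.isMaximalTree.exists_boundary_cut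
    (A := {r | Q ∩ R p ⊆ R r ∧ s ∉ R r}) (p := p) (q := q) ⟨Set.inter_subset_right, hsp⟩
    (fun hq => hq.2 hsq)
  have key {i j : G.V} (hiT : T e ⊆ R i) (hjT : T e ⊆ R j) (hi : Q ∩ R p ⊆ R i ∧ s ∉ R i)
      (hj : ¬ (Q ∩ R p ⊆ R j ∧ s ∉ R j)) : False := by
    -- A bag containing all of `Q ∩ R p` and also `s` would contradict maximality. So `T e` misses
    -- both `r` and `s`, and hence separates two points of `Q`.
    obtain ⟨r, hr, hrj⟩ : ∃ r ∈ Q ∩ R p, r ∉ R j := by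
      by_contra hsub
      push Not at hsub
      have hsj : s ∈ R j := by
        by_contra hsj
        exact hj ⟨hsub, hsj⟩
      exact hsp (hmax (y := Q ∩ R j) ⟨j, rfl⟩ (fun r hr => ⟨hr.1, hsub r hr⟩) ⟨hsQ, hsj⟩).2
    have hrT : r ∉ T e := fun hr' => hrj (hjT hr')
    have hsT : s ∉ T e := fun hs' => hi.2 (hiT hs')
    have hsep := h.isSeparation hc hpq ⟨hr.2, hrT⟩ ⟨hsq, hsT⟩
    rcases hsep.subset_or_subset (h.complete e) hQS hQ with h1 | h1
    · exact hsT (hsep.inter_eq ▸ ⟨h1 hsQ, q, rfl, hsq⟩)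
    · exact hrT (hsep.inter_eq ▸ ⟨⟨p, rfl, hr.2⟩, h1 hr.1⟩)
  rcases he with ⟨h1, h2⟩ | ⟨h1, h2⟩
  · exact key (h.ssubset_src e).1 (h.ssubset_tgt e).1 h1 h2
  · exact key (h.ssubset_tgt e).1 (h.ssubset_src e).1 h1 h2

theorem maximalUnseparated_eq (hS : S.Finite) : maximalUnseparated S = Set.range R := by
  ext Q
  refine ⟨fun hQ => ?_, ?_⟩
  · obtain ⟨p, hp⟩ := h.exists_subset_bag hS hQ.1.1 hQ.1.2
    exact ⟨p, Set.Subset.antisymm (hQ.2 ⟨h.bag_subset p, h.unseparated p⟩ hp) hp⟩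
  · rintro ⟨p, rfl⟩
    refine ⟨⟨h.bag_subset p, h.unseparated p⟩, fun Q hQ hpQ => ?_⟩
    obtain ⟨q, hq⟩ := h.exists_subset_bag hS hQ.1 hQ.2
    obtain rfl := h.eq_of_bag_subset (hpQ.trans hq)
    exact hq

/-- Take `a` and `b` in the two end bags, outside `T e`. A smaller separator is still complete, so
it leaves the end bags on opposite sides and contains their intersection. -/
theorem isRelativeMinimalSeparator (e : G.E) : IsRelativeMinimalSeparator S (T e) := by
  obtain ⟨c, hc⟩ := h.isMaximalTree.exists_cut e
  obtain ⟨a, ha⟩ := Set.nonempty_of_ssubset (h.ssubset_src e)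
  obtain ⟨b, hb⟩ := Set.nonempty_of_ssubset (h.ssubset_tgt e)
  refine ⟨a, h.bag_subset _ ha.1, b, h.bag_subset _ hb.1, h.isABSeparator hc hc.ne ha hb, ?_⟩
  rintro T' hT' ⟨S₁, S₂, hsep, haS, hbS⟩
  have hcomp : IsComplete T' := fun s hs t ht => h.complete e s (hT' hs) t (hT' ht)
  have h1 := (hsep.subset_or_subset hcomp (h.bag_subset _) (h.unseparated _)).resolve_right
    fun h2 => haS.2 (hsep.inter_eq ▸ ⟨haS.1, h2 ha.1⟩)
  have h2 := (hsep.subset_or_subset hcomp (h.bag_subset _) (h.unseparated _)).resolve_left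
    fun h2 => hbS.2 (hsep.inter_eq ▸ ⟨h2 hb.1, hbS.1⟩)
  refine hT'.antisymm fun t ht => ?_
  rw [hsep.inter_eq]
  exact ⟨h1 ((h.ssubset_src e).1 ht), h2 ((h.ssubset_tgt e).1 ht)⟩

theorem completeRelativeMinimalSeparators_eq :
    completeRelativeMinimalSeparators S = Set.range T := by
  ext Q
  refine ⟨?_, ?_⟩
  · rintro ⟨hQ, a, ha, b, hb, ⟨S₁, S₂, hsep, haS, hbS⟩, hmin⟩
    obtain ⟨p, hp⟩ := h.exists_mem_bag ha
    obtain ⟨q, hq⟩ := h.exists_mem_bag hb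
    have hor (r : G.V) := hsep.subset_or_subset hQ (h.bag_subset r) (h.unseparated r)
    have hp1 : R p ⊆ S₁ := (hor p).resolve_right
      fun h2 => haS.2 (hsep.inter_eq ▸ ⟨haS.1, h2 hp⟩)
    have hq1 : ¬ R q ⊆ S₁ := fun h2 => hbS.2 (hsep.inter_eq ▸ ⟨h2 hq, hbS.1⟩)
    -- On the way from `a` to `b` the bags leave `S₁` across some edge `e`. Its set `T e` lies in
    -- bags of both sides, so in `S₁ ∩ S₂`.
    obtain ⟨e, c, hc, hpq, he⟩ :=
      h.isMaximalTree.exists_boundary_cut (A := {r | R r ⊆ S₁}) hp1 hq1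
    have hsub : T e ⊆ Q := by
      rw [hsep.inter_eq]
      rcases he with ⟨h1, h2⟩ | ⟨h1, h2⟩
      · exact Set.subset_inter ((h.ssubset_src e).1.trans h1)
          ((h.ssubset_tgt e).1.trans ((hor _).resolve_left h2))
      · exact Set.subset_inter ((h.ssubset_tgt e).1.trans h1)
          ((h.ssubset_src e).1.trans ((hor _).resolve_left h2))
    exact ⟨e, hmin _ hsub (h.isABSeparator hc hpq ⟨hp, fun h3 => haS.2 (hsub h3)⟩
      ⟨hq, fun h3 => hbS.2 (hsub h3)⟩)⟩
  · rintro ⟨e, rfl⟩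
    exact ⟨h.complete e, h.isRelativeMinimalSeparator e⟩

end IsCompleteTree

end GraphOfGroups

/-! ### From the decomposition to a tree of bags -/

theorem Subgroup.setOf_eq_closure_mem_range {W : Type*} [Group W] {ι : Type*} (f : ι → Set W) :
    {H | ∃ Q ∈ Set.range f, H = Subgroup.closure Q} =
      Set.range fun i => Subgroup.closure (f i) := by
  ext H
  simp [eq_comm]

theorem theorem2p5 {B : Type*} [Finite B] {M : CoxeterMatrix B} {W : Type y} [Group W]
    (cs : CoxeterSystem M W) (S : Set W) (hS : S = Set.range cs.simple)
    (Ψ : GraphOfGroupsDecomposition.{u, v, w, x, y} W)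
    (hvisual : Ψ.IsVisual S) (hreduced : Ψ.IsReduced)
    (hvertex : ∀ V R, Ψ.IsVertexSystem S V R → ¬ CoxeterSeparation.SeparatedByComplete R)
    (hedge : ∀ e, ∃ T ⊆ S, CoxeterSeparation.IsComplete T ∧
      Ψ.edgeSubgroup e = Subgroup.closure T) :
    {H | ∃ R ∈ CoxeterSeparation.maximalUnseparated S, H = Subgroup.closure R} =
        Set.range Ψ.vertexSubgroup ∧
      {H | ∃ T ∈ CoxeterSeparation.completeRelativeMinimalSeparators S,
        H = Subgroup.closure T} = Set.range Ψ.edgeSubgroup := by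
  subst hS
  have hT : Ψ.tree = Set.univ := Ψ.tree_eq_univ cs.subgroup_closure_range_simple (by
    rintro _ ⟨i, rfl⟩
    exact isOfFinOrder_iff_pow_eq_one.2 ⟨2, two_pos, cs.simple_sq i⟩)
  choose R hRS hR using hvisual.1
  choose T hTS hTc hTe using hedge
  have hmemR {p : Ψ.gog.V} {s : W} (hs : s ∈ R p) : s ∈ Ψ.vertexSubgroup p :=
    hR p ▸ Subgroup.subset_closure hs
  have hmemT {e : Ψ.gog.E} {s : W} (hs : s ∈ Set.range cs.simple) (h : s ∈ Ψ.edgeSubgroup e) :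
      s ∈ T e := cs.mem_of_mem_closure_simple (hTS e) hs (hTe e ▸ h)
  have hside {p : Ψ.gog.V} {s : W} (hs : s ∈ R p) (c : Ψ.gog.V → Bool) :
      s ∈ Ψ.sideSubgroup c (c p) := Ψ.vertexSubgroup_le_sideSubgroup c p (hmemR hs)
  have hTR {e : Ψ.gog.E} {p : Ψ.gog.V} (hle : Ψ.edgeSubgroup e ≤ Ψ.vertexSubgroup p)
      (hne : Ψ.edgeSubgroup e ≠ Ψ.vertexSubgroup p) : T e ⊂ R p := by
    rw [hTe, hR] at hle hne
    exact (cs.subset_of_closure_le (hTS e) (hRS p) hle).ssubset_of_ne fun h => hne (h ▸ rfl)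
  have h : Ψ.gog.IsCompleteTree (Set.range cs.simple) R T :=
    { isMaximalTree := hT ▸ Ψ.isMaximalTree
      eq_iUnion := by
        refine Set.Subset.antisymm (fun s hs => ?_) (Set.iUnion_subset hRS)
        -- The vertex groups generate `W`, so the union of the bags generates every simple
        -- reflection and must contain it.
        refine cs.mem_of_mem_closure_simple (Set.iUnion_subset hRS) hs ?_
        rw [Subgroup.closure_iUnion, ← funext hR, Ψ.iSup_vertexSubgroup hT]
        trivial
      complete := hTc
      ssubset_src := fun e => hTR (Ψ.edgeSubgroup_le_src e) (hreduced.edgeSubgroup_ne hT e).1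
      ssubset_tgt := fun e => hTR (Ψ.edgeSubgroup_le_tgt (hT ▸ Set.mem_univ e))
        (hreduced.edgeSubgroup_ne hT e).2
      unseparated := fun p => hvertex _ _ ⟨⟨p, rfl⟩, hRS p, hR p⟩
      inter_subset := fun hc _ _ hpq s hs =>
        hmemT (hRS _ hs.1) (Ψ.mem_edgeSubgroup_of_cut hT hc hpq (hside hs.1 _) (hside hs.2 _))
      infinite_order := fun hc _ _ hpq a ha b hb =>
        Ψ.not_isOfFinOrder_mul_of_cut hT hc hpq (hside ha.1 _)
          (fun h => ha.2 (hmemT (hRS _ ha.1) h)) (hside hb.1 _)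
          (fun h => hb.2 (hmemT (hRS _ hb.1) h)) }
  rw [h.maximalUnseparated_eq (Set.finite_range _), h.completeRelativeMinimalSeparators_eq]
  rw [funext hR, funext hTe]
  exact ⟨Subgroup.setOf_eq_closure_mem_range R, Subgroup.setOf_eq_closure_mem_range T⟩
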